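/- Let $K$ be a field and $\overline{K}$ an algebraic closure of $K$. An absolute value on a field is a multiplicative map to $\mathbb{R}_{\ge 0}$ that satisfies the triangle inequality and vanishes only at $0$; two absolute values are equivalent if they define the same topology; $w\mid v$ means that $w$ restricts to $v$. A non-trivial absolute value $v$ on $K$ is called well-behaved if $[F:K]=\sum_{w\mid v}[F_w:K_v]$ for every finite extension $F/K$, where $w$ runs over all absolute values on $F$ extending $v$ and $F_w$, $K_v$ are the completions. It is called proper if it is non-trivial, well-behaved and, when $\operatorname{char}K=0$, its restriction to $\mathbb{Q}$ is equivalent to the trivial, a $p$-adic, or the usual absolute value. Let $M_K$ be a proper set of absolute values on $K$, i.e. a non-empty set of proper absolute values on $K$ such that distinct elements are inequivalent and, for every $x\in K\setminus\{0\}$, $|x|_v\ne 1$ for only finitely many $v\in M_K$. Let $M(\overline{K})$ be the set of absolute values on $\overline{K}$ whose restriction to $K$ belongs to $M_K$. Let $K\subset L\subset\overline{K}$ be an intermediate field with $[L:K]<\infty$. Let $X$ be a projective scheme over $L$, i.e. an $L$-scheme that has a closed immersion over $L$ into $\mathbb{P}^n_L$ for some $n>0$ (not necessarily reduced or irreducible).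 For an open subscheme $U\subset X$, $U(\overline{K})$ denotes the set of $L$-morphisms $\operatorname{Spec}\overline{K}\to U$. For an affine open $U\subset X$, a family $B=(B_v)_{v\in M(\overline{K})}$ of subsets $B_v\subset U(\overline{K})$ is called an $M_K$-bounded family of subsets of $U$ if (a) for every $v\in M(\overline{K})$ and every $f\in\mathcal{O}(U)$, $\sup_{x\in B_v}|f(x)|_v<\infty$; (b) for every $f\in\mathcal{O}(U)$, the quantity $C_{v_0,B}(f)=\sup_{v\in M(\overline{K}),\,v\mid v_0}\ \sup_{x\in B_v}|f(x)|_v$ is finite for every $v_0\in M_K$, and $C_{v_0,B}(f)\le 1$ for all but finitely many $v_0\in M_K$. Let $\{U_i\}_{i=1}^r$ be a finite affine open cover of $X$. Then there exist $M_K$-bounded families $B^i=(B^i_v)_{v\in M(\overline{K})}$ of subsets of $U_i$ $(i=1,\dots,r)$ such that $$\bigcup_{i=1}^r B^i_v = X(\overline{K})\qquad\text{for every } v\in M(\overline{K}).$$ -/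

import Mathlib

open CategoryTheory AlgebraicGeometry

universe u v

noncomputable section

namespace BddCover

/-! ### Absolute values -/

/-- If `w` on `F` extends `w₀` on `K`, the map `K → F` is continuous for the two topologies. -/
theorem continuous_map_of_liesOver {K F : Type*} [Field K] [Field F] [Algebra K F]
    (w₀ : AbsoluteValue K ℝ) (w : AbsoluteValue F ℝ) (h : w.LiesOver w₀) :
    Continuous (WithAbs.map w₀ w (algebraMap K F)) := by
  refine AddMonoidHomClass.continuous_of_bound (WithAbs.map w₀ w (algebraMap K F)) 1 fun x => ?_
  rw [one_mul, WithAbs.norm_eq_apply_ofAbs, WithAbs.norm_eq_apply_ofAbs]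
  exact (DFunLike.congr_fun h.comp_eq x.ofAbs).le

/-- The homomorphism of completions `K_{w₀} → F_w` induced by `K → F`, when `w` extends `w₀`. -/
def completionMap {K F : Type*} [Field K] [Field F] [Algebra K F]
    (w₀ : AbsoluteValue K ℝ) (w : AbsoluteValue F ℝ) (h : w.LiesOver w₀) :
    w₀.Completion →+* w.Completion :=
  UniformSpace.Completion.mapRingHom (WithAbs.map w₀ w (algebraMap K F))
    (continuous_map_of_liesOver w₀ w h)

/-- The local degree `[F_w : K_{w₀}]`, as a cardinal. -/
def localDegree {K F : Type u} [Field K] [Field F] [Algebra K F]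
    (w₀ : AbsoluteValue K ℝ) (w : AbsoluteValue F ℝ) (h : w.LiesOver w₀) : Cardinal.{u} :=
  letI : Module w₀.Completion w.Completion := (completionMap w₀ w h).toModule
  Module.rank w₀.Completion w.Completion

/-- `w₀` is well-behaved: `[F : K] = ∑_{w ∣ w₀} [F_w : K_{w₀}]` for every finite extension `F / K`,
the sum being over all absolute values `w` of `F` that extend `w₀`. Degrees and the sum are
cardinals, so that the equation asserts in particular that the right-hand side is finite. -/
def IsWellBehaved {K : Type u} [Field K] (w₀ : AbsoluteValue K ℝ) : Prop :=
  ∀ (F : Type u) [Field F] [Algebra K F] [FiniteDimensional K F],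
    Module.rank K F =
      Cardinal.sum fun w : {w : AbsoluteValue F ℝ // w.LiesOver w₀} => localDegree w₀ w.1 w.2

/-- A proper absolute value: non-trivial, well-behaved and, in characteristic zero, restricting on
`ℚ` to an absolute value equivalent to the trivial one, to a `p`-adic one or to the usual one. -/
structure IsProperAbs {K : Type u} [Field K] (w₀ : AbsoluteValue K ℝ) : Prop where
  isNontrivial : w₀.IsNontrivial
  isWellBehaved : IsWellBehaved w₀
  restrict_rat : ∀ _ : CharZero K,
    (w₀.comp (Rat.castHom K).injective).IsEquiv AbsoluteValue.trivial ∨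
    (∃ (p : ℕ) (_ : Fact p.Prime),
      (w₀.comp (Rat.castHom K).injective).IsEquiv (Rat.AbsoluteValue.padic p)) ∨
    (w₀.comp (Rat.castHom K).injective).IsEquiv Rat.AbsoluteValue.real

/-- A proper set of absolute values on `K`. -/
structure IsProperSet {K : Type u} [Field K] (MK : Set (AbsoluteValue K ℝ)) : Prop where
  nonempty : MK.Nonempty
  isProperAbs : ∀ w ∈ MK, IsProperAbs w
  not_isEquiv : ∀ w ∈ MK, ∀ w' ∈ MK, w ≠ w' → ¬ w.IsEquiv w'
  finite_ne_one : ∀ x : K, x ≠ 0 → {w | w ∈ MK ∧ w x ≠ 1}.Finite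

/-- `M(F)`: the absolute values on `F` whose restriction to `K` belongs to `MK`. -/
def absOver {K : Type v} [Field K] (MK : Set (AbsoluteValue K ℝ)) (F : Type u) [Field F]
    [Algebra K F] : Set (AbsoluteValue F ℝ) :=
  {w | w.comp (algebraMap K F).injective ∈ MK}

/-! ### Projective schemes and points -/

attribute [local instance] MvPolynomial.gradedAlgebra

/-- Projective space `ℙⁿ_k = Proj k[x₀, …, xₙ]`. -/
def projSpace (n : ℕ) (k : Type u) [Field k] : Scheme.{u} :=
  Proj (MvPolynomial.homogeneousSubmodule (Fin (n + 1)) k)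

/-- The structure morphism `ℙⁿ_k → Spec k`. -/
def projSpaceStr (n : ℕ) (k : Type u) [Field k] : projSpace n k ⟶ Spec (CommRingCat.of k) :=
  Proj.toSpecZero (MvPolynomial.homogeneousSubmodule (Fin (n + 1)) k) ≫
    Spec.map (CommRingCat.ofHom
      (algebraMap k (MvPolynomial.homogeneousSubmodule (Fin (n + 1)) k 0)))

/-- The `k`-scheme `s : X → Spec k` is projective: it has a closed immersion over `k` into some
`ℙⁿ_k`, `n > 0`. -/
def IsProjectiveScheme {k : Type u} [Field k] {X : Scheme.{u}}
    (s : X ⟶ Spec (CommRingCat.of k)) : Prop :=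
  ∃ n : ℕ, 0 < n ∧ ∃ i : X ⟶ projSpace n k, IsClosedImmersion i ∧ i ≫ projSpaceStr n k = s

/-- `X(F)`: the `F`-valued points of the `k`-scheme `s : X → Spec k`, i.e. the `k`-morphisms
`Spec F → X`. -/
def Points {k : Type u} [Field k] (F : Type u) [Field F] [Algebra k F] {X : Scheme.{u}}
    (s : X ⟶ Spec (CommRingCat.of k)) : Type u :=
  {x : Spec (CommRingCat.of F) ⟶ X // x ≫ s = Spec.map (CommRingCat.ofHom (algebraMap k F))}

section

variable {k : Type u} [Field k] {F : Type u} [Field F] [Algebra k F] {X : Scheme.{u}}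
  {s : X ⟶ Spec (CommRingCat.of k)} {U : X.Opens}

/-- The inclusion `U(F) → X(F)` for an open subscheme `U` of `X`. -/
def Points.incl (x : Points F (U.ι ≫ s)) : Points F s :=
  ⟨x.1 ≫ U.ι, (Category.assoc _ _ _).trans x.2⟩

/-- Evaluation `f ↦ f(x)` of regular functions `f ∈ 𝒪(U)` at a point `x ∈ U(F)`: the composite
`𝒪(U) = Γ(U, ⊤) → Γ(Spec F, ⊤) = F`. -/
def Points.eval (x : Points F (U.ι ≫ s)) : Γ(X, U) →+* F :=
  (U.topIso.inv ≫ x.1.appTop ≫ (Scheme.ΓSpecIso (CommRingCat.of F)).hom).hom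

end

/-! ### Bounded sets and bounded families -/

section

variable {k : Type u} [Field k] {F : Type u} [Field F] [Algebra k F] {X : Scheme.{u}}
  {s : X ⟶ Spec (CommRingCat.of k)} {U : X.Opens}

/-- `sup_{x ∈ B} |f(x)|_w`, as an element of `[0, ∞]`. -/
def supAbs (w : AbsoluteValue F ℝ) (B : Set (Points F (U.ι ≫ s))) (f : Γ(X, U)) : ENNReal :=
  ⨆ x ∈ B, ENNReal.ofReal (w (x.eval f))

/-- `B ⊆ U(F)` is bounded with respect to `U` and `w`. -/
def IsBddSet (w : AbsoluteValue F ℝ) (B : Set (Points F (U.ι ≫ s))) : Prop :=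
  ∀ f : Γ(X, U), supAbs w B f < ⊤

variable {K : Type v} [Field K] [Algebra K F] {MK : Set (AbsoluteValue K ℝ)}

/-- `C_{w₀, B}(f) = sup_{w ∣ w₀} sup_{x ∈ B_w} |f(x)|_w`, as an element of `[0, ∞]`. -/
def supFamily (B : absOver MK F → Set (Points F (U.ι ≫ s))) (w₀ : AbsoluteValue K ℝ)
    (f : Γ(X, U)) : ENNReal :=
  ⨆ (w : absOver MK F) (_ : w.1.LiesOver w₀), supAbs w.1 (B w) f

/-- `B = (B_w)_{w ∈ M(F)}` is an `MK`-bounded family of subsets of `U`. -/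
structure IsBddFamily (B : absOver MK F → Set (Points F (U.ι ≫ s))) : Prop where
  isBddSet : ∀ w : absOver MK F, IsBddSet w.1 (B w)
  supFamily_lt_top : ∀ f : Γ(X, U), ∀ w₀ ∈ MK, supFamily B w₀ f < ⊤
  finite_not_le_one : ∀ f : Γ(X, U), {w₀ | w₀ ∈ MK ∧ ¬ supFamily B w₀ f ≤ 1}.Finite

end

end BddCover

end

noncomputable section

namespace BddCover

attribute [local instance] MvPolynomial.gradedAlgebra

/-! ### Bounded functions with values in an algebraic extension -/

/-! All places and points are treated at once: a set of pairs $(w,x)$ is bounded in an open $U$ when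
every regular function on $U$, as a function of the pair, is bounded in the sense of `IsBddFun`,
uniformly over each $w_0$ and by $1$ for almost all $w_0$. Such functions form an $F$-algebra
(`bddFun`). Sums stay bounded by $1$ almost everywhere because $w_0$ is non-archimedean once
$|2|_{w_0}\le 1$, which fails for finitely many $w_0$ only; constants are bounded because they are
roots of monic polynomials over $K$.

Boundedness can therefore be tested on generators. In $\mathbb{P}^n$, dividing by a coordinate of
largest absolute value puts each point in a chart $D_+(x_j)$ with all $|x_i/x_j|\le 1$, and these
ratios generate the chart ring over $k$. As functions lift along a closed immersion on affines, the
points of $X$ form finitely many bounded sets in affine opens $V_j$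
(`IsProjectiveScheme.exists_isBddIn`).

To pass from $V_j$ to the given cover, take $h_1,\dots,h_m$ generating $\mathcal{O}(V_j)$ as an
ideal, with each $D(h_l)$ inside some $U_i$, and write $\sum g_l h_l=1$. Where $|h_l|$ is maximal,
$h_l^{-1}=\sum_i g_i\,(h_i/h_l)$ is bounded, hence so is every function on $D(h_l)$, in particular
every restriction from $U_i$ (`IsBddIn.exists_basicOpen`, `IsBddIn.exists_cover`). -/

lemma isNonarchimedean_of_natCast_le_one {F : Type*} [Field F] (w : AbsoluteValue F ℝ)
    (h : ∀ n : ℕ, w n ≤ 1) : IsNonarchimedean w := by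
  have : IsUltrametricDist (WithAbs w) := by
    refine IsUltrametricDist.isUltrametricDist_of_forall_norm_natCast_le_one fun n => ?_
    rw [WithAbs.norm_eq_apply_ofAbs]
    exact (congrArg w (map_natCast (WithAbs.equiv w) n)).trans_le (h n)
  intro x y
  simpa [WithAbs.norm_eq_apply_ofAbs] using
    IsUltrametricDist.norm_add_le_max (WithAbs.toAbs w x) (WithAbs.toAbs w y)

/-- In characteristic $p$, $n^p=n$ rules out $|n|>1$. In characteristic $0$, equivalence preserves
comparison with $1$, and $|2|\le 1$ excludes the usual absolute value. -/
lemma IsProperAbs.natCast_le_one {K : Type v} [Field K] {w₀ : AbsoluteValue K ℝ}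
    (h : IsProperAbs w₀) (h2 : w₀ 2 ≤ 1) (n : ℕ) : w₀ n ≤ 1 := by
  obtain ⟨p, hp⟩ := CharP.exists K
  rcases (CharP.char_is_prime_or_zero K p) with hp' | rfl
  · have := Fact.mk hp'
    have hn : (n : K) ^ p = n := by
      have := Fact.mk hp'
      exact map_natCast (frobenius K p) n
    by_contra! hlt
    have h1 : w₀ n ^ p = w₀ n := by rw [← map_pow, hn]
    have h3 : w₀ n ^ 1 < w₀ n ^ p := pow_lt_pow_right₀ hlt hp'.one_lt
    rw [h1, pow_one] at h3
    exact lt_irrefl _ h3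
  · have hz : CharZero K := CharP.charP_to_charZero K
    have key : ∀ m : ℕ, w₀ m = w₀.comp (Rat.castHom K).injective m := fun m =>
      congrArg w₀ (map_natCast (Rat.castHom K) m).symm
    rw [key n]
    rw [show (2 : K) = (2 : ℕ) by norm_num, key 2] at h2
    rcases h.restrict_rat hz with he | ⟨p, hp, he⟩ | he
    · have := (he n 1).2 (by
        rw [map_one]
        by_cases hn : n = 0
        · simp [hn]
        · rw [AbsoluteValue.trivial_apply (by exact_mod_cast hn)])
      rwa [map_one] at this
    · have := (he n 1).2 (by
        rw [map_one]
        exact_mod_cast Rat.AbsoluteValue.padic_le_one p n)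
      rwa [map_one] at this
    · have := (he (2 : ℕ) 1).1 (by rwa [map_one])
      norm_num [Rat.AbsoluteValue.real_eq_abs] at this

lemma IsProperSet.finite_not_isNonarchimedean {K : Type v} [Field K]
    {MK : Set (AbsoluteValue K ℝ)} (hMK : IsProperSet MK) :
    {w₀ | w₀ ∈ MK ∧ ¬ w₀ 2 ≤ 1}.Finite := by
  by_cases h : (2 : K) = 0
  · simp [h]
  · exact (hMK.finite_ne_one 2 h).subset fun w hw => ⟨hw.1, fun h' => hw.2 h'.le⟩

lemma apply_algebraMap_of_liesOver {K F : Type*} [Field K] [Field F] [Algebra K F]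
    {w₀ : AbsoluteValue K ℝ} {w : AbsoluteValue F ℝ} (h : w.LiesOver w₀) (x : K) :
    w (algebraMap K F x) = w₀ x :=
  DFunLike.congr_fun h.comp_eq x

lemma IsProperAbs.isNonarchimedean_of_liesOver {K : Type v} {F : Type u} [Field K] [Field F]
    [Algebra K F] {w₀ : AbsoluteValue K ℝ} (h : IsProperAbs w₀) (h2 : w₀ 2 ≤ 1)
    {w : AbsoluteValue F ℝ} (hw : w.LiesOver w₀) : IsNonarchimedean w :=
  isNonarchimedean_of_natCast_le_one w fun n => by
    have := apply_algebraMap_of_liesOver hw (n : K)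
    rw [map_natCast] at this
    exact this.trans_le (h.natCast_le_one h2 n)

section

variable {K F : Type*} [Field K] [Field F] [Algebra K F]

lemma pow_natDegree_eq_of_isRoot {p : Polynomial K} (hp : p.Monic) {c : F}
    (hc : p.aeval c = 0) :
    c ^ p.natDegree = - ∑ i ∈ Finset.range p.natDegree, algebraMap K F (p.coeff i) * c ^ i := by
  rw [hp.as_sum] at hc
  simp only [map_add, map_pow, Polynomial.aeval_X, map_sum, map_mul, Polynomial.aeval_C] at hc
  exact eq_neg_of_add_eq_zero_left hc

/-- Cauchy's root bound: if $|c|>1$, compare $c^d=-\sum_{i<d}a_ic^i$ with $|c|^{d-1}$. The bound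
involves $w_0$ only, so it is uniform in $w\mid w_0$. -/
lemma le_of_isRoot {p : Polynomial K} (hp : p.Monic) {c : F} (hc : p.aeval c = 0)
    {w₀ : AbsoluteValue K ℝ} {w : AbsoluteValue F ℝ} (hw : w.LiesOver w₀) :
    w c ≤ 1 + ∑ i ∈ Finset.range p.natDegree, w₀ (p.coeff i) := by
  have hS : 0 ≤ ∑ i ∈ Finset.range p.natDegree, w₀ (p.coeff i) :=
    Finset.sum_nonneg fun i _ => w₀.nonneg _
  by_cases h1 : w c ≤ 1
  · linarith
  push Not at h1
  obtain ⟨n, hn⟩ : ∃ n, p.natDegree = n + 1 := by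
    refine Nat.exists_eq_succ_of_ne_zero fun h0 => ?_
    have := pow_natDegree_eq_of_isRoot hp hc
    simp [h0] at this
  have hb : w c ^ (n + 1) ≤ (∑ i ∈ Finset.range p.natDegree, w₀ (p.coeff i)) * w c ^ n := by
    rw [← map_pow, ← hn, pow_natDegree_eq_of_isRoot hp hc, w.map_neg, Finset.sum_mul]
    refine (w.sum_le _ _).trans (Finset.sum_le_sum fun i hi => ?_)
    rw [map_mul, apply_algebraMap_of_liesOver hw, map_pow]
    gcongr
    · exact h1.le
    · rw [Finset.mem_range] at hi; omega
  rw [pow_succ'] at hb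
  linarith [le_of_mul_le_mul_right hb (by positivity)]

lemma le_one_of_isRoot {p : Polynomial K} (hp : p.Monic) {c : F} (hc : p.aeval c = 0)
    {w₀ : AbsoluteValue K ℝ} {w : AbsoluteValue F ℝ} (hw : w.LiesOver w₀)
    (hna : IsNonarchimedean w) (hle : ∀ i, w₀ (p.coeff i) ≤ 1) : w c ≤ 1 := by
  by_contra! h1
  obtain ⟨n, hn⟩ : ∃ n, p.natDegree = n + 1 := by
    refine Nat.exists_eq_succ_of_ne_zero fun h0 => ?_
    have := pow_natDegree_eq_of_isRoot hp hc
    simp [h0] at this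
  obtain ⟨i, hi, hs⟩ := hna.finset_image_add_of_nonempty
    (fun i => algebraMap K F (p.coeff i) * c ^ i) (t := Finset.range p.natDegree) (by simp [hn])
  have h2 : w c ^ (n + 1) ≤ w c ^ n := by
    rw [← map_pow, ← hn, pow_natDegree_eq_of_isRoot hp hc, w.map_neg]
    refine hs.trans ?_
    rw [map_mul, apply_algebraMap_of_liesOver hw, map_pow, ← one_mul (w c ^ n)]
    rw [Finset.mem_range] at hi
    gcongr
    · exact hle i
    · exact h1.le
    · omega
  exact absurd h2 (not_le.2 (pow_lt_pow_right₀ h1 n.lt_succ_self))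

end

section

variable {K : Type v} [Field K] {F : Type u} [Field F] [Algebra K F]
  {MK : Set (AbsoluteValue K ℝ)} {T : Type*}

/-- A function `g` on a set `T` over `M(F)` is bounded if it is bounded over each `w₀ ∈ MK`, with
bound `1` for all but finitely many `w₀`. -/
structure IsBddFun (π : T → absOver MK F) (g : T → F) : Prop where
  exists_le : ∀ w₀ ∈ MK, ∃ C : ℝ, ∀ t, (π t).1.LiesOver w₀ → (π t).1 (g t) ≤ C
  finite_not_le_one :
    {w₀ | w₀ ∈ MK ∧ ¬ ∀ t, (π t).1.LiesOver w₀ → (π t).1 (g t) ≤ 1}.Finite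

lemma IsBddFun.of_le_one {π : T → absOver MK F} {g : T → F} (h : ∀ t, (π t).1 (g t) ≤ 1) :
    IsBddFun π g :=
  ⟨fun _ _ => ⟨1, fun t _ => h t⟩, by
    convert Set.finite_empty
    ext w₀
    simpa using fun _ t _ => h t⟩

lemma IsBddFun.comp {T' : Type*} {π : T → absOver MK F} {g : T → F} (h : IsBddFun π g)
    (e : T' → T) : IsBddFun (π ∘ e) (g ∘ e) :=
  ⟨fun w₀ hw => (h.exists_le w₀ hw).imp fun _ hC t => hC (e t),
    h.finite_not_le_one.subset fun _ hw => ⟨hw.1, fun h' => hw.2 fun t => h' (e t)⟩⟩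

lemma IsBddFun.mul {π : T → absOver MK F} {g h : T → F} (hg : IsBddFun π g)
    (hh : IsBddFun π h) : IsBddFun π (g * h) := by
  refine ⟨fun w₀ hw => ?_, (hg.finite_not_le_one.union hh.finite_not_le_one).subset ?_⟩
  · obtain ⟨C, hC⟩ := hg.exists_le w₀ hw
    obtain ⟨D, hD⟩ := hh.exists_le w₀ hw
    refine ⟨C * D, fun t ht => ?_⟩
    rw [Pi.mul_apply, map_mul]
    exact mul_le_mul (hC t ht) (hD t ht) ((π t).1.nonneg _) (((π t).1.nonneg _).trans (hC t ht))
  · rintro w₀ ⟨hw, hn⟩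
    by_contra hcon
    simp only [Set.mem_union, Set.mem_ofPred_eq, hw, true_and, not_or, not_not] at hcon
    refine hn fun t ht => ?_
    rw [Pi.mul_apply, map_mul]
    exact mul_le_one₀ (hcon.1 t ht) ((π t).1.nonneg _) (hcon.2 t ht)

/-- The bound $1$ survives addition only where the ultrametric inequality holds, so the finitely
many $w_0$ with $|2|_{w_0}>1$ join the exceptional set. -/
lemma IsBddFun.add (hMK : IsProperSet MK) {π : T → absOver MK F} {g h : T → F}
    (hg : IsBddFun π g) (hh : IsBddFun π h) : IsBddFun π (g + h) := by
  refine ⟨fun w₀ hw => ?_, ((hg.finite_not_le_one.union hh.finite_not_le_one).union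
    hMK.finite_not_isNonarchimedean).subset ?_⟩
  · obtain ⟨C, hC⟩ := hg.exists_le w₀ hw
    obtain ⟨D, hD⟩ := hh.exists_le w₀ hw
    exact ⟨C + D, fun t ht => ((π t).1.add_le _ _).trans (add_le_add (hC t ht) (hD t ht))⟩
  · rintro w₀ ⟨hw, hn⟩
    by_contra hcon
    simp only [Set.mem_union, Set.mem_ofPred_eq, hw, true_and, not_or, not_not] at hcon
    exact hn fun t ht => ((hMK.isProperAbs w₀ hw).isNonarchimedean_of_liesOver hcon.2 ht _ _).trans
      (max_le (hcon.1.1 t ht) (hcon.1.2 t ht))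

/-- The root bounds apply to the minimal polynomial over $K$: its finitely many nonzero coefficients
have absolute value $1$ at almost all $w_0$. -/
lemma IsBddFun.const [Algebra.IsAlgebraic K F] (hMK : IsProperSet MK) (π : T → absOver MK F)
    (c : F) : IsBddFun π (fun _ => c) := by
  have hi : IsIntegral K c := Algebra.IsIntegral.isIntegral c
  have hm := minpoly.monic hi
  have hr := minpoly.aeval K c
  refine ⟨fun w₀ _ => ⟨_, fun t ht => le_of_isRoot hm hr ht⟩, ?_⟩
  have hfin : (⋃ i ∈ (minpoly K c).support,
      {w₀ | w₀ ∈ MK ∧ w₀ ((minpoly K c).coeff i) ≠ 1}).Finite :=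
    Set.Finite.biUnion (Finset.finite_toSet _) fun i hi =>
      hMK.finite_ne_one _ (Polynomial.mem_support_iff.1 hi)
  refine (hfin.union hMK.finite_not_isNonarchimedean).subset ?_
  rintro w₀ ⟨hw, hn⟩
  by_contra hcon
  simp only [Set.mem_union, Set.mem_iUnion, Set.mem_ofPred_eq, hw, true_and, not_or, not_not,
    not_exists] at hcon
  refine hn fun t ht => le_one_of_isRoot hm hr ht
    ((hMK.isProperAbs w₀ hw).isNonarchimedean_of_liesOver hcon.2 ht) fun i => ?_
  by_cases hi : i ∈ (minpoly K c).support
  · exact (hcon.1 i hi).le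
  · simp [Polynomial.notMem_support_iff.1 hi]

/-- The algebra of bounded functions on a set over `M(F)`. -/
def bddFun [Algebra.IsAlgebraic K F] (hMK : IsProperSet MK) (π : T → absOver MK F) :
    Subalgebra F (T → F) where
  carrier := {g | IsBddFun π g}
  mul_mem' := IsBddFun.mul
  add_mem' := IsBddFun.add hMK
  algebraMap_mem' c := IsBddFun.const hMK π c

lemma mem_bddFun [Algebra.IsAlgebraic K F] {hMK : IsProperSet MK} {π : T → absOver MK F}
    {g : T → F} : g ∈ bddFun hMK π ↔ IsBddFun π g := Iff.rfl

/-- If bounded functions `h i` generate the unit ideal of the bounded functions, then `(h i)⁻¹` is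
bounded where `h i` has maximal absolute value. -/
lemma isBddFun_inv_of_sum_mul_eq_one [Algebra.IsAlgebraic K F] (hMK : IsProperSet MK)
    {π : T → absOver MK F} {ι : Type*} {s : Finset ι} {g h : ι → T → F}
    (hg : ∀ i ∈ s, IsBddFun π (g i)) (h1 : ∀ t, ∑ i ∈ s, g i t * h i t = 1) (j : ι)
    (hmax : ∀ t, ∀ i ∈ s, (π t).1 (h i t) ≤ (π t).1 (h j t)) :
    (∀ t, h j t ≠ 0) ∧ IsBddFun π (h j)⁻¹ := by
  -- If the largest $|h_i(t)|$ is $0$, then all $h_i(t)$ vanish and the sum cannot be $1$.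
  have h0 : ∀ t, h j t ≠ 0 := fun t h0 => by
    refine one_ne_zero ((h1 t).symm.trans (Finset.sum_eq_zero fun i hi => ?_))
    have := hmax t i hi
    rw [h0, map_zero] at this
    rw [(π t).1.eq_zero.1 (this.antisymm ((π t).1.nonneg _)), mul_zero]
  refine ⟨h0, ?_⟩
  have : (h j)⁻¹ = ∑ i ∈ s, g i * (h i * (h j)⁻¹) := by
    ext t
    simp only [Finset.sum_apply, Pi.mul_apply, ← mul_assoc, ← Finset.sum_mul, h1, one_mul]
  rw [this, ← mem_bddFun (hMK := hMK)]
  refine sum_mem fun i hi => mul_mem (hg i hi) (IsBddFun.of_le_one fun t => ?_)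
  rw [Pi.mul_apply, Pi.inv_apply, map_mul, map_inv₀, ← div_eq_mul_inv]
  exact div_le_one_of_le₀ (hmax t i hi) ((π t).1.nonneg _)

end

/-! ### Evaluation of regular functions at field-valued points -/

section

variable {F : Type u} [Field F] {X Y : Scheme.{u}}

/-- Evaluation of regular functions on `U` at an `F`-valued point of `X` that lies in `U`. -/
def evalAt (U : X.Opens) (x : Spec (CommRingCat.of F) ⟶ X) (h : ⊤ ≤ x ⁻¹ᵁ U) : Γ(X, U) →+* F :=
  (x.appLE U ⊤ h ≫ (Scheme.ΓSpecIso (CommRingCat.of F)).hom).hom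

lemma evalAt_map {U V : X.Opens} (i : V ≤ U) (x : Spec (CommRingCat.of F) ⟶ X) (h : ⊤ ≤ x ⁻¹ᵁ V)
    (f : Γ(X, U)) :
    evalAt V x h (X.presheaf.map (homOfLE i).op f) =
      evalAt U x (h.trans ((TopologicalSpace.Opens.map x.base).map (homOfLE i)).le) f := by
  exact DFunLike.congr_fun (congrArg
    (fun g => (g ≫ (Scheme.ΓSpecIso (CommRingCat.of F)).hom).hom)
    (Scheme.Hom.map_appLE x h (homOfLE i).op)) f

lemma evalAt_comp (i : X ⟶ Y) (V : Y.Opens) (x : Spec (CommRingCat.of F) ⟶ X)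
    (h : ⊤ ≤ x ⁻¹ᵁ i ⁻¹ᵁ V) (f : Γ(Y, V)) :
    evalAt (i ⁻¹ᵁ V) x h (i.app V f) = evalAt V (x ≫ i) h f := by
  exact DFunLike.congr_fun (congrArg
    (fun g => (g ≫ (Scheme.ΓSpecIso (CommRingCat.of F)).hom).hom)
    (Scheme.Hom.comp_appLE x i V ⊤ h)).symm f

/-- The pulled-back function lives on the spectrum of a field: it is either a unit, with full basic
open, or zero, with empty basic open. -/
lemma top_le_preimage_basicOpen_iff {U : X.Opens} (x : Spec (CommRingCat.of F) ⟶ X)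
    (h : ⊤ ≤ x ⁻¹ᵁ U) (f : Γ(X, U)) : ⊤ ≤ x ⁻¹ᵁ X.basicOpen f ↔ evalAt U x h f ≠ 0 := by
  have h1 : (Spec (CommRingCat.of F)).basicOpen (x.appLE U ⊤ h f) = x ⁻¹ᵁ X.basicOpen f := by
    rw [Scheme.basicOpen_appLE, top_inf_eq]
  have h2 : IsUnit (x.appLE U ⊤ h f) ↔ evalAt U x h f ≠ 0 := by
    rw [← isUnit_iff_ne_zero, evalAt, CommRingCat.hom_comp, RingHom.comp_apply]
    exact (MulEquiv.isUnit_map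
      (Scheme.ΓSpecIso (CommRingCat.of F)).commRingCatIsoToRingEquiv).symm
  rw [← h2, ← h1, top_le_iff]
  refine ⟨fun ht => ?_, fun hu => Scheme.basicOpen_of_isUnit _ hu⟩
  by_contra hu
  have h0 : x.appLE U ⊤ h f = 0 := by
    rw [h2, not_not] at hu
    exact (map_eq_zero_iff _
      (Scheme.ΓSpecIso (CommRingCat.of F)).commRingCatIsoToRingEquiv.injective).1 hu
  rw [h0, Scheme.basicOpen_zero] at ht
  have : IsLocalRing.closedPoint F ∈ (⊥ : (Spec (CommRingCat.of F)).Opens) := by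
    rw [ht]
    trivial
  exact this

lemma top_le_preimage_of_mem (x : Spec (CommRingCat.of F) ⟶ X) {U : X.Opens}
    (p : Spec (CommRingCat.of F)) (hp : x p ∈ U) : ⊤ ≤ x ⁻¹ᵁ U := by
  intro q _
  have : Subsingleton (Spec (CommRingCat.of F)) :=
    inferInstanceAs (Subsingleton (PrimeSpectrum F))
  rw [Subsingleton.elim q p]
  exact hp

lemma exists_top_le_preimage {ι : Sort*} (x : Spec (CommRingCat.of F) ⟶ X) {U : ι → X.Opens}
    {V : X.Opens} (hV : ⊤ ≤ x ⁻¹ᵁ V) (h : V ≤ ⨆ i, U i) : ∃ i, ⊤ ≤ x ⁻¹ᵁ U i := by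
  let p : Spec (CommRingCat.of F) := IsLocalRing.closedPoint F
  obtain ⟨i, hi⟩ := TopologicalSpace.Opens.mem_iSup.1 (h (hV (Set.mem_univ p)))
  exact ⟨i, top_le_preimage_of_mem x p hi⟩

variable {k : Type u} [Field k] [Algebra k F] {s : X ⟶ Spec (CommRingCat.of k)} {U : X.Opens}

lemma Points.top_le_preimage (x : Points F (U.ι ≫ s)) : ⊤ ≤ x.incl.1 ⁻¹ᵁ U := by
  intro p _
  exact (x.1 p).2

/-- Links `Points.eval`, defined through the open subscheme, to `evalAt`, which keeps the point in
$X$ and so allows $U$ to vary. -/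
lemma topIso_inv_comp_appTop (y : Spec (CommRingCat.of F) ⟶ U.toScheme)
    (h : ⊤ ≤ (y ≫ U.ι) ⁻¹ᵁ U) : U.topIso.inv ≫ y.appTop = (y ≫ U.ι).appLE U ⊤ h := by
  have h1 : U.topIso.inv = U.ι.appLE U ⊤ U.ι_preimage_self.ge := by
    rw [Scheme.Opens.ι_appLE]
    rfl
  rw [h1, Scheme.Hom.appTop, Scheme.Hom.app_eq_appLE]
  exact Scheme.Hom.appLE_comp_appLE y U.ι U ⊤ ⊤ _ _

lemma Points.eval_eq_evalAt (x : Points F (U.ι ≫ s)) :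
    x.eval = evalAt U x.incl.1 x.top_le_preimage :=
  congrArg (fun g => (g ≫ (Scheme.ΓSpecIso (CommRingCat.of F)).hom).hom)
    (topIso_inv_comp_appTop x.1 x.top_le_preimage)

lemma Points.exists_incl_eq (x : Points F s) (h : ⊤ ≤ x.1 ⁻¹ᵁ U) :
    ∃ y : Points F (U.ι ≫ s), y.incl = x := by
  have hr : Set.range x.1 ⊆ Set.range U.ι := by
    rw [Scheme.Opens.range_ι]
    rintro _ ⟨p, rfl⟩
    exact h (Set.mem_univ p)
  refine ⟨⟨IsOpenImmersion.lift U.ι x.1 hr, ?_⟩, Subtype.ext (IsOpenImmersion.lift_fac _ _ hr)⟩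
  rw [← Category.assoc, IsOpenImmersion.lift_fac, x.2]

end

/-! ### Bounded sets of pairs of an absolute value and a point -/

section

variable {K : Type v} [Field K] {F : Type u} [Field F] [Algebra K F]
  {MK : Set (AbsoluteValue K ℝ)} {k : Type u} [Field k] [Algebra k F] {X : Scheme.{u}}
  {s : X ⟶ Spec (CommRingCat.of k)}

/-- A set of pairs `(w, x)`, `w ∈ M(F)` and `x ∈ X(F)`, is bounded in `U` if all `x` lie in `U` and
every regular function on `U` is bounded on it. -/
structure IsBddIn (S : Set (absOver MK F × Points F s)) (U : X.Opens) : Prop where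
  top_le : ∀ p ∈ S, ⊤ ≤ p.2.1 ⁻¹ᵁ U
  isBddFun : ∀ f : Γ(X, U),
    IsBddFun (fun p : S => p.1.1) (fun p : S => evalAt U p.1.2.1 (top_le p.1 p.2) f)

lemma IsBddIn.mono {S S' : Set (absOver MK F × Points F s)} {U : X.Opens} (h : IsBddIn S U)
    (hS : S' ⊆ S) : IsBddIn S' U :=
  ⟨fun p hp => h.top_le p (hS hp), fun f => (h.isBddFun f).comp (Set.inclusion hS)⟩

lemma IsBddIn.of_le {S : Set (absOver MK F × Points F s)} {U V : X.Opens} (h : IsBddIn S V)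
    (hV : V ≤ U) : IsBddIn S U :=
  ⟨fun p hp => (h.top_le p hp).trans ((TopologicalSpace.Opens.map p.2.1.base).map (homOfLE hV)).le,
    fun f => by
      convert h.isBddFun (X.presheaf.map (homOfLE hV).op f) using 2
      rw [evalAt_map]⟩

lemma IsBddIn.iUnion {ι : Type*} [Finite ι] {S : ι → Set (absOver MK F × Points F s)}
    {U : X.Opens} (h : ∀ i, IsBddIn (S i) U) : IsBddIn (⋃ i, S i) U := by
  cases nonempty_fintype ι
  refine ⟨fun p hp => ?_, fun f => ⟨fun w₀ hw => ?_, ?_⟩⟩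
  · obtain ⟨i, hi⟩ := Set.mem_iUnion.1 hp
    exact (h i).top_le p hi
  · choose C hC using fun i => ((h i).isBddFun f).exists_le w₀ hw
    obtain ⟨D, hD⟩ := Set.finite_range C |>.bddAbove
    refine ⟨D, fun ⟨p, hp⟩ ht => ?_⟩
    obtain ⟨i, hi⟩ := Set.mem_iUnion.1 hp
    exact (hC i ⟨p, hi⟩ ht).trans (hD ⟨i, rfl⟩)
  · refine (Set.finite_iUnion fun i => ((h i).isBddFun f).finite_not_le_one).subset ?_
    rintro w₀ ⟨hw, hn⟩
    by_contra hcon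
    simp only [Set.mem_iUnion, Set.mem_ofPred_eq, hw, true_and, not_exists, not_not] at hcon
    refine hn fun ⟨p, hp⟩ ht => ?_
    obtain ⟨i, hi⟩ := Set.mem_iUnion.1 hp
    exact hcon i ⟨p, hi⟩ ht

/-- A bounded set in an affine open `V` is the union of bounded sets in basic opens
`D(h)`, `h ∈ t`, if `t` generates the unit ideal of `𝒪(V)`. -/
lemma IsBddIn.exists_basicOpen [Algebra.IsAlgebraic K F] (hMK : IsProperSet MK)
    {S : Set (absOver MK F × Points F s)} {V : X.Opens} (hV : IsAffineOpen V) (hS : IsBddIn S V)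
    {t : Finset Γ(X, V)} (ht : Ideal.span (t : Set Γ(X, V)) = ⊤) :
    ∃ S' : t → Set (absOver MK F × Points F s),
      (∀ h, IsBddIn (S' h) (X.basicOpen h.1)) ∧ S ⊆ ⋃ h, S' h := by
  obtain ⟨g, hg⟩ : ∃ g : Γ(X, V) → Γ(X, V), ∑ h ∈ t, g h * h = 1 := by
    have : (1 : Γ(X, V)) ∈ Ideal.span (t : Set Γ(X, V)) := ht ▸ Submodule.mem_top
    obtain ⟨g, -, hg⟩ := Submodule.mem_span_finset.1 this
    exact ⟨g, hg⟩
  -- The piece attached to $j\in t$ consists of the pairs at which $|j|$ is maximal among the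
  -- members of $t$.
  refine ⟨fun j => {p | ∃ hp : p ∈ S, ∀ h ∈ t,
    p.1.1 (evalAt V p.2.1 (hS.top_le p hp) h) ≤ p.1.1 (evalAt V p.2.1 (hS.top_le p hp) j)},
    fun j => ?_, fun p hp => ?_⟩
  · generalize hS' : {p | ∃ hp : p ∈ S, ∀ h ∈ t,
      p.1.1 (evalAt V p.2.1 (hS.top_le p hp) h) ≤
        p.1.1 (evalAt V p.2.1 (hS.top_le p hp) j)} = S'
    have hsub : S' ⊆ S := by
      rw [← hS']
      exact fun p hp => hp.1
    have hb := hS.mono hsub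
    obtain ⟨h0, hinv⟩ := isBddFun_inv_of_sum_mul_eq_one hMK (s := t)
      (g := fun h (p : S') => evalAt V p.1.2.1 (hb.top_le p.1 p.2) (g h))
      (h := fun h (p : S') => evalAt V p.1.2.1 (hb.top_le p.1 p.2) h)
      (fun h _ => hb.isBddFun (g h))
      (fun p => by simp only [← map_mul, ← map_sum, hg, map_one]) j
      (fun p h hh => by
        have := hS'.ge p.2
        exact this.2 h hh)
    change IsBddIn {p | ∃ hp : p ∈ S, ∀ h ∈ t, p.1.1 (evalAt V p.2.1 (hS.top_le p hp) h) ≤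
      p.1.1 (evalAt V p.2.1 (hS.top_le p hp) j)} _
    rw [hS']
    refine ⟨fun p hp => (top_le_preimage_basicOpen_iff _ (hb.top_le p hp) _).2 (h0 ⟨p, hp⟩),
      fun f => ?_⟩
    -- Since $V$ is affine, $f=a/j^n$ with $a\in\mathcal{O}(V)$; both $a$ and $j^{-1}$ are bounded
    -- on the piece.
    have := hV.isLocalization_basicOpen j.1
    obtain ⟨⟨a, b, n, hn⟩, hab⟩ := IsLocalization.surj (Submonoid.powers j.1) f
    have hinv' := (bddFun hMK _).mul_mem (hb.isBddFun a) (pow_mem (mem_bddFun.2 hinv) n)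
    rw [mem_bddFun] at hinv'
    convert hinv' using 1
    funext p
    have hle := X.basicOpen_le j.1
    have htop := (top_le_preimage_basicOpen_iff _ (hb.top_le p.1 p.2) _).2 (h0 p)
    have key := congrArg (evalAt (X.basicOpen j.1) p.1.2.1 htop) hab
    rw [map_mul] at key
    dsimp only at key hn
    subst hn
    change _ * evalAt _ _ htop (X.presheaf.map (homOfLE hle).op (j.1 ^ n)) =
      evalAt _ _ htop (X.presheaf.map (homOfLE hle).op a) at key
    rw [evalAt_map, evalAt_map, map_pow] at key
    simp only [Pi.mul_apply, Pi.pow_apply, Pi.inv_apply]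
    rw [← key, inv_pow, mul_inv_cancel_right₀ (pow_ne_zero _ (h0 p))]
  · have hne : t.Nonempty := by
      rw [Finset.nonempty_iff_ne_empty]
      rintro rfl
      have := congrArg (evalAt V p.2.1 (hS.top_le p hp)) hg
      simp at this
    obtain ⟨j, hj, hmax⟩ :=
      t.exists_max_image (fun h => p.1.1 (evalAt V p.2.1 (hS.top_le p hp) h)) hne
    exact Set.mem_iUnion.2 ⟨⟨j, hj⟩, hp, hmax⟩

/-- A bounded set in an affine open `V` is the union of bounded sets in the members of an open
cover. -/
lemma IsBddIn.exists_cover [Algebra.IsAlgebraic K F] (hMK : IsProperSet MK)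
    {S : Set (absOver MK F × Points F s)} {V : X.Opens} (hV : IsAffineOpen V) (hS : IsBddIn S V)
    {ι : Type*} {U : ι → X.Opens} (hU : V ≤ ⨆ i, U i) :
    ∃ S' : ι → Set (absOver MK F × Points F s), (∀ i, IsBddIn (S' i) (U i)) ∧ S ⊆ ⋃ i, S' i := by
  -- Basic opens of the affine $V$ form a base, so those contained in some $U_i$ already cover $V$.
  have hspan : Ideal.span {f : Γ(X, V) | ∃ i, X.basicOpen f ≤ U i} = ⊤ := by
    rw [← hV.iSup_basicOpen_eq_self_iff]
    refine le_antisymm (iSup_le fun f => X.basicOpen_le _) fun x hx => ?_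
    obtain ⟨i, hi⟩ := TopologicalSpace.Opens.mem_iSup.1 (hU hx)
    obtain ⟨f, hf, hxf⟩ := hV.exists_basicOpen_le ⟨x, hi⟩ hx
    exact TopologicalSpace.Opens.mem_iSup.2 ⟨⟨f, i, hf⟩, hxf⟩
  obtain ⟨t, hts, ht⟩ := (Ideal.span_eq_top_iff_finite _).1 hspan
  choose i hi using fun f : t => hts f.2
  obtain ⟨S', hS', hcov⟩ := hS.exists_basicOpen hMK hV ht
  refine ⟨fun j => ⋃ f : {f : t // i f = j}, S' f.1,
    fun j => IsBddIn.iUnion fun f => (hS' f.1).of_le ((hi f.1).trans_eq (congrArg U f.2)), fun p hp => ?_⟩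
  obtain ⟨f, hf⟩ := Set.mem_iUnion.1 (hcov hp)
  exact Set.mem_iUnion.2 ⟨i f, Set.mem_iUnion.2 ⟨⟨f, rfl⟩, hf⟩⟩

/-- The fibres of a bounded set in `U` are a bounded family of subsets of `U`. -/
lemma IsBddIn.isBddFamily {S : Set (absOver MK F × Points F s)} {U : X.Opens} (hS : IsBddIn S U) :
    IsBddFamily (fun w : absOver MK F => {x : Points F (U.ι ≫ s) | (w, x.incl) ∈ S}) := by
  have hlt : ∀ f : Γ(X, U), ∀ w₀ ∈ MK, supFamily (fun w : absOver MK F =>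
      {x : Points F (U.ι ≫ s) | (w, x.incl) ∈ S}) w₀ f < ⊤ := fun f w₀ hw => by
    obtain ⟨C, hC⟩ := (hS.isBddFun f).exists_le w₀ hw
    refine lt_of_le_of_lt (iSup₂_le fun w hw' => iSup₂_le fun x hx => ?_)
      (ENNReal.ofReal_lt_top (r := C))
    rw [x.eval_eq_evalAt]
    exact ENNReal.ofReal_le_ofReal (hC ⟨_, hx⟩ hw')
  refine ⟨fun w f => lt_of_le_of_lt ?_ (hlt f _ w.2), hlt, fun f =>
    (hS.isBddFun f).finite_not_le_one.subset ?_⟩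
  · exact le_iSup₂_of_le (f := fun (w' : absOver MK F) (_ : w'.1.LiesOver _) => _) w ⟨rfl⟩ le_rfl
  · rintro w₀ ⟨hw, hn⟩
    refine ⟨hw, fun hle => hn (iSup₂_le fun w hw' => iSup₂_le fun x hx => ?_)⟩
    rw [x.eval_eq_evalAt, ENNReal.ofReal_le_one]
    exact hle ⟨_, hx⟩ hw'

end

/-! ### Points of projective space -/

section

open HomogeneousLocalization

variable {n : ℕ} {k : Type u} [Field k] {F : Type u} [Field F]

/-- The coordinate ring of the standard chart `D₊(x_j)` of `ℙⁿ_k`. -/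
abbrev chartRing (n : ℕ) (k : Type u) [Field k] (j : Fin (n + 1)) : Type u :=
  Away (MvPolynomial.homogeneousSubmodule (Fin (n + 1)) k) (MvPolynomial.X j)

lemma X_mem_homogeneousSubmodule (j : Fin (n + 1)) :
    MvPolynomial.X j ∈ MvPolynomial.homogeneousSubmodule (Fin (n + 1)) k 1 :=
  MvPolynomial.isHomogeneous_X k j

/-- The function `x_i / x_j` on the standard chart `D₊(x_j)`. -/
def ratio (k : Type u) [Field k] (j i : Fin (n + 1)) : chartRing n k j :=
  Away.mk _ (X_mem_homogeneousSubmodule j) 1 (MvPolynomial.X i) (X_mem_homogeneousSubmodule i)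

/-- The standard chart of `ℙⁿ_k` as an open immersion. -/
abbrev chartι (n : ℕ) (k : Type u) [Field k] (j : Fin (n + 1)) :
    Spec (CommRingCat.of (chartRing n k j)) ⟶
      Proj (MvPolynomial.homogeneousSubmodule (Fin (n + 1)) k) :=
  Proj.awayι _ (MvPolynomial.X j) (X_mem_homogeneousSubmodule j) one_pos

lemma ratio_self (j : Fin (n + 1)) : ratio k j j = 1 := by
  apply val_injective
  rw [ratio, Away.val_mk, val_one, Localization.mk_eq_mk', IsLocalization.mk'_eq_iff_eq_mul]
  simp

/-- Change of chart to an index $m$ maximising $|x_m/x_{j_0}|$. This ratio is nonzero because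
$x_{j_0}/x_{j_0}=1$ competes, so the point lies in $D_+(x_{j_0}x_m)$. -/
lemma exists_ratio_le_one (w : AbsoluteValue F ℝ) (j₀ : Fin (n + 1))
    (φ₀ : chartRing n k j₀ →+* F) :
    ∃ (j : Fin (n + 1)) (φ : chartRing n k j →+* F),
      Spec.map (CommRingCat.ofHom φ₀) ≫ chartι n k j₀ =
        Spec.map (CommRingCat.ofHom φ) ≫ chartι n k j ∧ ∀ i, w (φ (ratio k j i)) ≤ 1 := by
  obtain ⟨m, -, hm⟩ := Finset.univ.exists_max_image (fun i => w (φ₀ (ratio k j₀ i)))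
    Finset.univ_nonempty
  have h0 : φ₀ (ratio k j₀ m) ≠ 0 := fun h => by
    have := hm j₀ (Finset.mem_univ _)
    rw [ratio_self, h, map_one, map_one, map_zero] at this
    linarith
  obtain ⟨x, hx⟩ : ∃ x : MvPolynomial (Fin (n + 1)) k, x = MvPolynomial.X j₀ * MvPolynomial.X m :=
    ⟨_, rfl⟩
  have hx' := hx.trans (mul_comm _ _)
  let a₀ := awayMap _ (X_mem_homogeneousSubmodule m) hx
  let a := awayMap _ (X_mem_homogeneousSubmodule j₀) hx'
  -- The ring of $D_+(x_{j_0}x_m)$ is the chart ring of $j_0$ with $x_m/x_{j_0}$ inverted, so `φ₀`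
  -- extends to it.
  have hψ : ∃ ψ :
      Away (MvPolynomial.homogeneousSubmodule (Fin (n + 1)) k) x →+* F, ψ.comp a₀ = φ₀ := by
    let := a₀.toAlgebra
    have hloc := Away.isLocalization_mul (X_mem_homogeneousSubmodule j₀)
      (X_mem_homogeneousSubmodule m) hx one_ne_zero
    have hu : IsUnit (φ₀ (Away.isLocalizationElem (X_mem_homogeneousSubmodule j₀)
      (X_mem_homogeneousSubmodule m))) := by
      rw [isUnit_iff_ne_zero]
      convert h0 using 3
      simp [ratio, Away.isLocalizationElem]
    exact ⟨IsLocalization.Away.lift _ hu, IsLocalization.Away.lift_comp _ hu⟩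
  obtain ⟨ψ, hψ⟩ := hψ
  refine ⟨m, ψ.comp a, ?_, fun i => ?_⟩
  · rw [← hψ, CommRingCat.ofHom_comp, CommRingCat.ofHom_comp, Spec.map_comp, Spec.map_comp,
      Category.assoc, Category.assoc]
    congr 1
    rw [Proj.SpecMap_awayMap_awayι, Proj.SpecMap_awayMap_awayι]
  -- On the overlap, $(x_m/x_{j_0})(x_i/x_m)=x_i/x_{j_0}$; maximality of $m$ then gives
  -- $|x_i/x_m|\le 1$.
  · have hmul : a₀ (ratio k j₀ m) * a (ratio k m i) = a₀ (ratio k j₀ i) := by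
      apply val_injective
      simp only [a₀, a, ratio, awayMap_mk, val_mul, Away.val_mk, Localization.mk_mul]
      rw [Localization.mk_eq_mk_iff, Localization.r_iff_exists]
      refine ⟨1, ?_⟩
      simp only [hx, OneMemClass.coe_one, one_mul, Submonoid.coe_mul, pow_one]
      ring
    have hmul' := congrArg (fun z => w (ψ z)) hmul
    have h1 : ∀ z, ψ (a₀ z) = φ₀ z := fun z => DFunLike.congr_fun hψ z
    simp only [map_mul, h1] at hmul'
    have hpos : 0 < w (φ₀ (ratio k j₀ m)) := w.pos h0
    refine le_of_mul_le_mul_left ?_ hpos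
    rw [mul_one]
    exact hmul'.trans_le (hm i (Finset.mem_univ _))

/-- The results used on `Proj` take the degree-zero part as base ring; it contains the image of $k$,
so generation over $k$ suffices. -/
lemma adjoin_range_X_eq_top :
    Algebra.adjoin (MvPolynomial.homogeneousSubmodule (Fin (n + 1)) k 0)
      (Set.range (MvPolynomial.X : Fin (n + 1) → MvPolynomial (Fin (n + 1)) k)) = ⊤ := by
  rw [← top_le_iff]
  rintro p -
  have : p ∈ Algebra.adjoin k
      (Set.range (MvPolynomial.X : Fin (n + 1) → MvPolynomial (Fin (n + 1)) k)) := by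
    rw [MvPolynomial.adjoin_range_X]
    trivial
  induction this using Algebra.adjoin_induction with
  | mem x hx => exact Algebra.subset_adjoin hx
  | algebraMap r =>
    exact Subalgebra.algebraMap_mem _
      (algebraMap k (MvPolynomial.homogeneousSubmodule (Fin (n + 1)) k 0) r)
  | add x y _ _ hx hy => exact add_mem hx hy
  | mul x y _ _ hx hy => exact mul_mem hx hy

lemma exists_eq_chartι (y : Spec (CommRingCat.of F) ⟶
    Proj (MvPolynomial.homogeneousSubmodule (Fin (n + 1)) k)) :
    ∃ (j : Fin (n + 1)) (φ : chartRing n k j →+* F),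
      y = Spec.map (CommRingCat.ofHom φ) ≫ chartι n k j := by
  obtain ⟨j, hj⟩ := exists_top_le_preimage y (V := ⊤) le_top
    (Proj.iSup_basicOpen_eq_top' (MvPolynomial.homogeneousSubmodule (Fin (n + 1)) k)
      MvPolynomial.X (fun i => ⟨1, X_mem_homogeneousSubmodule i⟩) adjoin_range_X_eq_top).ge
  rw [← Proj.opensRange_awayι _ _ (X_mem_homogeneousSubmodule j) one_pos] at hj
  have hr : Set.range y ⊆ Set.range (chartι n k j) := by
    rintro _ ⟨p, rfl⟩
    exact hj (Set.mem_univ p)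
  obtain ⟨φ, hφ⟩ := Spec.map_surjective (IsOpenImmersion.lift (chartι n k j) y hr)
  refine ⟨j, φ.hom, ?_⟩
  rw [CommRingCat.ofHom_hom, hφ, IsOpenImmersion.lift_fac]

lemma exists_eq_chartι_of_absoluteValue (w : AbsoluteValue F ℝ) (y : Spec (CommRingCat.of F) ⟶
    Proj (MvPolynomial.homogeneousSubmodule (Fin (n + 1)) k)) :
    ∃ (j : Fin (n + 1)) (φ : chartRing n k j →+* F),
      y = Spec.map (CommRingCat.ofHom φ) ≫ chartι n k j ∧ ∀ i, w (φ (ratio k j i)) ≤ 1 := by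
  obtain ⟨j₀, φ₀, rfl⟩ := exists_eq_chartι y
  exact exists_ratio_le_one w j₀ φ₀

lemma top_le_preimage_chartι (j : Fin (n + 1)) (φ : chartRing n k j →+* F) :
    ⊤ ≤ (Spec.map (CommRingCat.ofHom φ) ≫ chartι n k j) ⁻¹ᵁ Proj.basicOpen _ (MvPolynomial.X j) := by
  rw [← Proj.opensRange_awayι _ _ (X_mem_homogeneousSubmodule j) one_pos]
  intro p _
  exact ⟨Spec.map (CommRingCat.ofHom φ) p, rfl⟩

/-- Through the isomorphism of $D_+(x_j)$ with the spectrum of the chart ring, the point becomes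
`Spec.map` of `φ`, and naturality of `Scheme.ΓSpecIso` returns `φ`. -/
lemma evalAt_chartι (j : Fin (n + 1)) (φ : chartRing n k j →+* F) (a : chartRing n k j) :
    evalAt _ (Spec.map (CommRingCat.ofHom φ) ≫ chartι n k j) (top_le_preimage_chartι j φ)
      (Proj.awayToSection _ (MvPolynomial.X j) a) = φ a := by
  let 𝒜 := MvPolynomial.homogeneousSubmodule (Fin (n + 1)) k
  let U := Proj.basicOpen 𝒜 (MvPolynomial.X j)
  let e := Proj.basicOpenIsoSpec 𝒜 (MvPolynomial.X j) (X_mem_homogeneousSubmodule j) one_pos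
  let z : Spec (CommRingCat.of F) ⟶ U.toScheme := Spec.map (CommRingCat.ofHom φ) ≫ e.inv
  have h1 := topIso_inv_comp_appTop z (top_le_preimage_chartι j φ)
  have h2 : z ≫ Proj.basicOpenToSpec 𝒜 (MvPolynomial.X j) = Spec.map (CommRingCat.ofHom φ) := by
    rw [← Proj.basicOpenIsoSpec_hom 𝒜 (MvPolynomial.X j) (X_mem_homogeneousSubmodule j) one_pos]
    simp only [z, e, Category.assoc, Iso.inv_hom_id, Category.comp_id]
  have h3 : Proj.awayToSection 𝒜 (MvPolynomial.X j) ≫ U.topIso.inv =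
      (Scheme.ΓSpecIso _).inv ≫ (Proj.basicOpenToSpec 𝒜 (MvPolynomial.X j)).appTop := by
    rw [Iso.eq_inv_comp]
    exact (Proj.basicOpenToSpec_app_top 𝒜 (MvPolynomial.X j)).symm
  have h4 : Proj.awayToSection 𝒜 (MvPolynomial.X j) ≫ U.topIso.inv ≫ z.appTop ≫
      (Scheme.ΓSpecIso (CommRingCat.of F)).hom = CommRingCat.ofHom φ := by
    rw [reassoc_of% h3, ← Scheme.Hom.comp_appTop_assoc, h2, Scheme.ΓSpecIso_naturality,
      Iso.inv_hom_id_assoc]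
  rw [reassoc_of% h1] at h4
  exact DFunLike.congr_fun (congrArg CommRingCat.Hom.hom h4) a

lemma chartι_comp_projSpaceStr (j : Fin (n + 1)) :
    chartι n k j ≫ projSpaceStr n k = Spec.map (CommRingCat.ofHom
      ((fromZeroRingHom (MvPolynomial.homogeneousSubmodule (Fin (n + 1)) k) _).comp
        (algebraMap k (MvPolynomial.homogeneousSubmodule (Fin (n + 1)) k 0)))) := by
  rw [projSpaceStr, CommRingCat.ofHom_comp, Spec.map_comp]
  exact Proj.awayι_toSpecZero_assoc _ _ _ _ _

lemma algebraMap_eq_of_chartι_comp_projSpaceStr [Algebra k F] (j : Fin (n + 1))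
    (φ : chartRing n k j →+* F)
    (h : (Spec.map (CommRingCat.ofHom φ) ≫ chartι n k j) ≫ projSpaceStr n k =
      Spec.map (CommRingCat.ofHom (algebraMap k F))) (c : k) :
    φ (algebraMap _ _ (algebraMap k (MvPolynomial.homogeneousSubmodule (Fin (n + 1)) k 0) c)) =
      algebraMap k F c := by
  replace h := (Category.assoc _ (chartι n k j) (projSpaceStr n k)).symm.trans h
  rw [chartι_comp_projSpaceStr, ← Spec.map_comp, ← CommRingCat.ofHom_comp] at h
  exact DFunLike.congr_fun (congrArg CommRingCat.Hom.hom (Spec.map_injective h)) c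

lemma algebraMap_homogeneousSubmodule_zero_surjective :
    Function.Surjective (algebraMap k (MvPolynomial.homogeneousSubmodule (Fin (n + 1)) k 0)) := by
  rintro ⟨p, hp⟩
  rw [MvPolynomial.mem_homogeneousSubmodule] at hp
  refine ⟨p.coeff 0, Subtype.ext ?_⟩
  exact (MvPolynomial.totalDegree_eq_zero_iff_eq_C.1
    (Nat.le_zero.1 (MvPolynomial.IsHomogeneous.totalDegree_le hp))).symm

/-- Puts the module generators of the chart ring over its degree-zero base into the form of
monomials in the ratios, which are visibly bounded. -/
lemma mk_prod_pow_eq_prod_ratio_pow (j : Fin (n + 1)) (a : ℕ) (d : Fin (n + 1) → ℕ)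
    (hd : ∑ i, d i • 1 = a • 1)
    (h : ∏ i, (MvPolynomial.X i : MvPolynomial (Fin (n + 1)) k) ^ d i ∈
      MvPolynomial.homogeneousSubmodule (Fin (n + 1)) k (a • 1)) :
    Away.mk _ (X_mem_homogeneousSubmodule j) a (∏ i, MvPolynomial.X i ^ d i) h =
      ∏ i, ratio k j i ^ d i := by
  apply val_injective
  rw [← HomogeneousLocalization.algebraMap_apply, ← HomogeneousLocalization.algebraMap_apply, map_prod]
  simp only [map_pow, HomogeneousLocalization.algebraMap_apply, ratio, Away.val_mk, Localization.mk_pow,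
    Localization.mk_prod]
  congr 1
  ext
  simp only [smul_eq_mul, mul_one] at hd
  simp [Finset.prod_pow_eq_pow_sum, hd]

end

section

variable {K : Type v} [Field K] {F : Type u} [Field F] [Algebra K F]
  {MK : Set (AbsoluteValue K ℝ)} {k : Type u} [Field k] [Algebra k F] {T : Type*} {n : ℕ}

/-- Functions on the standard chart are bounded on points where all coordinates are at most `1`. -/
lemma isBddFun_of_ratio_le_one [Algebra.IsAlgebraic K F] (hMK : IsProperSet MK)
    (π : T → absOver MK F) (j : Fin (n + 1)) (φ : T → chartRing n k j →+* F)
    (hφ : ∀ t c, φ t (algebraMap _ _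
      (algebraMap k (MvPolynomial.homogeneousSubmodule (Fin (n + 1)) k 0) c)) = algebraMap k F c)
    (hle : ∀ t i, (π t).1 (φ t (ratio k j i)) ≤ 1) (a : chartRing n k j) :
    IsBddFun π (fun t => φ t a) := by
  -- With all `φ t` bundled into one homomorphism, the claim is that its image lies in the
  -- subalgebra of bounded functions, which is checked on generators.
  let Φ : chartRing n k j →+* (T → F) := RingHom.pi φ
  suffices Φ a ∈ bddFun hMK π from this
  have ha : a ∈ (⊤ : Submodule (MvPolynomial.homogeneousSubmodule (Fin (n + 1)) k 0) _) :=
    Submodule.mem_top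
  rw [← HomogeneousLocalization.Away.span_mk_prod_pow_eq_top (X_mem_homogeneousSubmodule j)
    MvPolynomial.X adjoin_range_X_eq_top (fun _ => 1) X_mem_homogeneousSubmodule] at ha
  induction ha using Submodule.span_induction with
  | mem x hx =>
    obtain ⟨m, d, hd, rfl⟩ := hx
    rw [mk_prod_pow_eq_prod_ratio_pow j m d hd, map_prod]
    refine prod_mem fun i _ => ?_
    rw [map_pow]
    exact pow_mem (mem_bddFun.2 (IsBddFun.of_le_one fun t => hle t i)) _
  | zero => rw [map_zero]; exact zero_mem _
  | add x y _ _ hx hy => rw [map_add]; exact add_mem hx hy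
  | smul c x _ hx =>
    obtain ⟨c, rfl⟩ := algebraMap_homogeneousSubmodule_zero_surjective c
    rw [Algebra.smul_def, map_mul]
    refine mul_mem ?_ hx
    convert (bddFun hMK π).algebraMap_mem (algebraMap k F c) using 1
    funext t
    exact hφ t c

/-- The points of a projective scheme form a finite union of bounded sets in affine opens. -/
lemma IsProjectiveScheme.exists_isBddIn [Algebra.IsAlgebraic K F] (hMK : IsProperSet MK)
    {X : Scheme.{u}} {s : X ⟶ Spec (CommRingCat.of k)} (hX : IsProjectiveScheme s) :
    ∃ (n : ℕ) (V : Fin n → X.Opens) (S : Fin n → Set (absOver MK F × Points F s)),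
      (∀ j, IsAffineOpen (V j)) ∧ (∀ j, IsBddIn (S j) (V j)) ∧ ⋃ j, S j = Set.univ := by
  obtain ⟨n, -, i', hi', his⟩ := hX
  -- Retypes the immersion with `projSpace` unfolded to `Proj`.
  obtain ⟨i, rfl⟩ : ∃ i : X ⟶ Proj (MvPolynomial.homogeneousSubmodule (Fin (n + 1)) k), i = i' :=
    ⟨i', rfl⟩
  have hi : IsClosedImmersion i := hi'
  have haff (j : Fin (n + 1)) : IsAffineOpen (Proj.basicOpen
      (MvPolynomial.homogeneousSubmodule (Fin (n + 1)) k) (MvPolynomial.X j)) :=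
    Proj.isAffineOpen_basicOpen _ _ (X_mem_homogeneousSubmodule j) one_pos
  refine ⟨n + 1, fun j => i ⁻¹ᵁ Proj.basicOpen _ (MvPolynomial.X j), fun j => {p |
    ∃ φ : chartRing n k j →+* F, p.2.1 ≫ i = Spec.map (CommRingCat.ofHom φ) ≫ chartι n k j ∧
      ∀ l, p.1.1 (φ (ratio k j l)) ≤ 1}, fun j => (haff j).preimage i, fun j => ?_, ?_⟩
  · refine ⟨?_, fun f => ?_⟩
    · rintro p ⟨φ, hφ, -⟩
      have := top_le_preimage_chartι j φ
      rw [← hφ] at this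
      exact this
    -- A closed immersion is surjective on functions over an affine open, so `f` comes from an
    -- element `a` of the chart ring.
    · obtain ⟨g, rfl⟩ := i.app_surjective _ (haff j) f
      obtain ⟨a, rfl⟩ : ∃ a, Proj.awayToSection _ (MvPolynomial.X j) a = g := by
        rw [← Proj.basicOpenIsoAway_hom _ _ (X_mem_homogeneousSubmodule j) one_pos]
        exact (ConcreteCategory.bijective_of_isIso _).2 g
      choose φ hφ hle using fun p : {p : absOver MK F × Points F s |
        ∃ φ : chartRing n k j →+* F, p.2.1 ≫ i = Spec.map (CommRingCat.ofHom φ) ≫ chartι n k j ∧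
          ∀ l, p.1.1 (φ (ratio k j l)) ≤ 1} => p.2
      convert isBddFun_of_ratio_le_one (k := k) hMK _ j φ (fun p c => ?_) hle a using 1
      · funext p
        rw [evalAt_comp]
        refine Eq.trans ?_ (evalAt_chartι j (φ p) a)
        congr 1
        simp only [hφ]
      · refine algebraMap_eq_of_chartι_comp_projSpaceStr j (φ p) ?_ c
        rw [← hφ]
        exact (Category.assoc p.1.2.1 i (projSpaceStr n k)).trans
          ((congrArg (p.1.2.1 ≫ ·) his).trans p.1.2.2)
  · refine Set.eq_univ_of_forall fun p => ?_
    obtain ⟨j, φ, h⟩ := exists_eq_chartι_of_absoluteValue p.1.1 (p.2.1 ≫ i)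
    exact Set.mem_iUnion.2 ⟨j, φ, h⟩

/-- The points of a projective scheme are covered by bounded families of subsets of the members of
an open cover. -/
theorem IsProjectiveScheme.exists_isBddFamily_cover [Algebra.IsAlgebraic K F]
    (hMK : IsProperSet MK) {X : Scheme.{u}} {s : X ⟶ Spec (CommRingCat.of k)}
    (hX : IsProjectiveScheme s) {ι : Type*} (U : ι → X.Opens) (hcov : ⨆ i, U i = ⊤) :
    ∃ B : ∀ i, absOver MK F → Set (Points F ((U i).ι ≫ s)), (∀ i, IsBddFamily (B i)) ∧
      ∀ w, ⋃ i, Points.incl '' (B i w) = (Set.univ : Set (Points F s)) := by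
  obtain ⟨n, V, S, hV, hS, hSu⟩ := hX.exists_isBddIn (F := F) hMK
  -- Each bounded set `S j` is split along the cover; the pieces for a fixed $U_i$ are then united
  -- over the finitely many `j`.
  choose S' hS' hcov' using fun j => (hS j).exists_cover hMK (hV j) (U := U) (by simp [hcov])
  have hb (i : ι) : IsBddIn (⋃ j, S' j i) (U i) :=
    IsBddIn.iUnion fun j => hS' j i
  refine ⟨fun i w => {x : Points F ((U i).ι ≫ s) | (w, x.incl) ∈ ⋃ j, S' j i},
    fun i => (hb i).isBddFamily, fun w => Set.eq_univ_of_forall fun x => ?_⟩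
  obtain ⟨j, hj⟩ := Set.mem_iUnion.1 (hSu.ge (Set.mem_univ (w, x)))
  obtain ⟨i, hi⟩ := Set.mem_iUnion.1 (hcov' j hj)
  have hx : (w, x) ∈ ⋃ j, S' j i := Set.mem_iUnion.2 ⟨j, hi⟩
  have htop : ⊤ ≤ x.1 ⁻¹ᵁ U i := (hb i).top_le (w, x) hx
  obtain ⟨y, hy⟩ := x.exists_incl_eq (U := U i) htop
  have hy' : (w, y.incl) ∈ ⋃ j, S' j i := by rwa [hy]
  exact Set.mem_iUnion.2 ⟨i, ⟨y, hy', hy⟩⟩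

end

end BddCover

end

theorem mainTheorem8 {K : Type v} [Field K] {Kbar : Type u} [Field Kbar] [Algebra K Kbar]
    [IsAlgClosure K Kbar] (MK : Set (AbsoluteValue K ℝ)) (hMK : BddCover.IsProperSet MK)
    (L : IntermediateField K Kbar) [FiniteDimensional K L]
    (X : Scheme.{u}) (s : X ⟶ Spec (CommRingCat.of L)) (hX : BddCover.IsProjectiveScheme s)
    {r : ℕ} (U : Fin r → X.Opens) (hU : ∀ i, IsAffineOpen (U i)) (hcov : ⨆ i, U i = ⊤) :
    ∃ B : ∀ i : Fin r, BddCover.absOver MK Kbar → Set (BddCover.Points Kbar ((U i).ι ≫ s)),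
      (∀ i, BddCover.IsBddFamily (B i)) ∧
      ∀ w : BddCover.absOver MK Kbar,
        ⋃ i, BddCover.Points.incl '' (B i w) = (Set.univ : Set (BddCover.Points Kbar s)) := by
  have : Algebra.IsAlgebraic K Kbar := IsAlgClosure.isAlgebraic
  exact hX.exists_isBddFamily_cover hMK U hcov
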